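/- Let $\Sigma$ be an alphabet and let $\Xi=\{x_1,\dots,x_n\}$ be a set of $n$ unknowns. A word equation $E$ on $n$ unknowns is a pair of words $u,v\in\Xi^*$, written $u=v$; it is trivial if $u$ and $v$ are the same word. A solution of $E$ is a morphism $h:\Xi^*\to\Sigma^*$ with $h(u)=h(v)$; a solution of a system of equations is a common solution of all of them. The length type of $h$ is the vector $(|h(x_1)|,\dots,|h(x_n)|)$, and the rank of $h$ is the smallest size of a set $A$ of words such that $h(x)\in A^*$ for every unknown $x$. For $L\in\mathbb N_0^n$ let $\mathrm{len}_L:\Xi^*\to\mathbb N_0$ be the monoid morphism with $\mathrm{len}_L(x_j)=L_j$ for all $j$. For an equation $E: y_1\cdots y_k=z_1\cdots z_l$ (with $y_i,z_i\in\Xi$), an unknown $x$ and $L\in\mathbb N_0^n$, put $$q_{E,x,L}=\sum_{y_i=x}X^{\mathrm{len}_L(y_1\cdots y_{i-1})}-\sum_{z_i=x}X^{\mathrm{len}_L(z_1\cdots z_{i-1})}\in\mathbb Z[X].$$ **Theorem.** Let $E_1,\dots,E_m$ be a system of word equations on $n$ unknowns, let $L\in\mathbb N_0^n$, and let $q_{ij}=q_{E_i,x_j,L}$.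 Ranks of matrices of polynomials are taken over the field of fractions of $\mathbb Z[X]$. 1. If the system has a solution of length type $L$ that has rank $r$, then the rank of the $m\times n$ matrix $(q_{ij})$ is at most $n-r$. 2. If the rank of the matrix $(q_{ij})$ is $1$, at most one component of $L$ is zero and all the equations $E_1,\dots,E_m$ are nontrivial, then $E_1,\dots,E_m$ all have the same solutions of length type $L$. -/

import Mathlib

open Polynomial

/-- A coefficient-free word equation `u = v` on the unknowns `x_1, …, x_n`: a pair of words
over the set of unknowns. -/
structure WordEquation (n : ℕ) where
  lhs : FreeMonoid (Fin n)
  rhs : FreeMonoid (Fin n)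

namespace WordEquation

/-- The two sides are the same word. -/
def IsTrivial {n : ℕ} (E : WordEquation n) : Prop :=
  E.lhs = E.rhs

/-- The morphism `h` from words over the unknowns to words over the alphabet `A` is a solution. -/
def IsSolution {n : ℕ} {A : Type*} (E : WordEquation n)
    (h : FreeMonoid (Fin n) →* FreeMonoid A) : Prop :=
  h E.lhs = h E.rhs

end WordEquation

/-- The combinatorial rank of a morphism: the least size of a set `S` of words with
`h x ∈ S*` for every unknown `x` (the set of all `h x` is always such a set `S`). -/
noncomputable def morphismRank {n : ℕ} {A : Type*}
    (h : FreeMonoid (Fin n) →* FreeMonoid A) : ℕ :=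
  sInf {r : ℕ | ∃ S : Finset (FreeMonoid A), S.card = r ∧
    ∀ x : Fin n, h (FreeMonoid.of x) ∈ Submonoid.closure (S : Set (FreeMonoid A))}

/-- The length type `(|h(x_1)|, …, |h(x_n)|)` of a morphism. -/
def lengthType {n : ℕ} {A : Type*} (h : FreeMonoid (Fin n) →* FreeMonoid A) : Fin n → ℕ :=
  fun x => (h (FreeMonoid.of x)).length

/-- The length of the word `y_1 … y_k` over the unknowns determined by the length type `L`:
`L(y_1) + … + L(y_k)`. -/
def lenOf {n : ℕ} (L : Fin n → ℕ) (w : List (Fin n)) : ℕ :=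
  (w.map L).sum

/-- For `w = y_1 … y_k`, the sum of `X ^ len_L(y_1 … y_{i-1})` over all `i` with `y_i = x`
(here positions are counted from `0`). -/
noncomputable def positionPoly {n : ℕ} (L : Fin n → ℕ) (x : Fin n) (w : List (Fin n)) : ℤ[X] :=
  ∑ i ∈ Finset.range w.length, if w[i]? = some x then X ^ lenOf L (w.take i) else 0

/-- The polynomial `q_{E,x,L}`. -/
noncomputable def WordEquation.q {n : ℕ} (E : WordEquation n) (x : Fin n) (L : Fin n → ℕ) :
    ℤ[X] :=
  positionPoly L x E.lhs.toList - positionPoly L x E.rhs.toList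

/-- The `m × n` matrix `(q_{E_i,x_j,L})` of a system of equations. -/
noncomputable def qMatrix {m n : ℕ} (E : Fin m → WordEquation n) (L : Fin n → ℕ) :
    Matrix (Fin m) (Fin n) ℤ[X] :=
  Matrix.of fun i j => (E i).q j L

/-- The rank of a matrix of polynomials, as a matrix over the field of fractions of `ℤ[X]`. -/
noncomputable def polyRank {m n : ℕ} (M : Matrix (Fin m) (Fin n) ℤ[X]) : ℕ :=
  (M.map (algebraMap ℤ[X] (FractionRing ℤ[X]))).rank

/-! Encode a word by one polynomial per letter t, summing X^(weight of the prefix) over the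
occurrences of t. Under a morphism f whose images have weights L, these transform linearly
(`wordPoly_hom`), so for a solution f the vector over the unknowns x of the polynomials of t in f(x)
lies in the kernel of (q_ij).

Claim 1: factor h as g ∘ f, with f a solution all of whose letters begin some f(x). Giving t the
weight |g(t)| > 0, the constant terms of these kernel vectors contain an identity matrix. So the
kernel has dimension at least the number of letters used, which is at least the rank of h.

Claim 2: with unit weights orthogonality also implies being a solution, and in a rank-one matrix
with nonzero rows all rows have the same orthogonal vectors. -/

/-- The position polynomial of a letter in a word over an arbitrary alphabet, by recursion. -/
noncomputable def wordPoly {T : Type*} [DecidableEq T] (l : T → ℕ) (t : T) : List T → ℤ[X]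
  | [] => 0
  | c :: w => (if c = t then 1 else 0) + X ^ l c * wordPoly l t w

/-! ### Position polynomials and linearity -/

section WordPoly

variable {T : Type*} [DecidableEq T]

theorem positionPoly_eq_wordPoly {n : ℕ} (L : Fin n → ℕ) (x : Fin n) (w : List (Fin n)) :
    positionPoly L x w = wordPoly L x w := by
  induction w with
  | nil => simp [positionPoly, wordPoly]
  | cons c w ih =>
    rw [wordPoly, ← ih, positionPoly, List.length_cons, Finset.sum_range_succ', add_comm,
      positionPoly, Finset.mul_sum]
    congr 1
    · simp [lenOf]
    · refine Finset.sum_congr rfl fun i _ => ?_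
      simp [lenOf, pow_add]

theorem wordPoly_append (l : T → ℕ) (t : T) (u v : List T) :
    wordPoly l t (u ++ v) = wordPoly l t u + X ^ (u.map l).sum * wordPoly l t v := by
  induction u with
  | nil => simp [wordPoly]
  | cons c u ih =>
    simp only [List.cons_append, wordPoly, ih, List.map_cons, List.sum_cons, pow_add]
    ring

theorem wordPoly_hom {n : ℕ} (f : FreeMonoid (Fin n) →* FreeMonoid T) (l : T → ℕ)
    (L : Fin n → ℕ) (hL : ∀ x, ((f (FreeMonoid.of x)).toList.map l).sum = L x) (t : T)
    (u : FreeMonoid (Fin n)) :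
    wordPoly l t (f u).toList =
      ∑ x, wordPoly L x u.toList * wordPoly l t (f (FreeMonoid.of x)).toList := by
  induction u using FreeMonoid.inductionOn' with
  | one => simp [wordPoly]
  | of_mul c w ih =>
    rw [map_mul, FreeMonoid.toList_mul, wordPoly_append, hL, ih, FreeMonoid.toList_mul,
      FreeMonoid.toList_of, List.singleton_append]
    simp [wordPoly, add_mul, Finset.sum_add_distrib, Finset.mul_sum, mul_assoc]

theorem coeff_zero_wordPoly_cons {l : T → ℕ} {c : T} (hc : l c ≠ 0) (t : T) (w : List T) :
    (wordPoly l t (c :: w)).coeff 0 = if c = t then 1 else 0 := by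
  rw [wordPoly, coeff_add, mul_coeff_zero, coeff_X_pow, if_neg (Ne.symm hc)]
  split_ifs <;> simp

theorem coeff_zero_wordPoly_nonneg (l : T → ℕ) (t : T) (w : List T) :
    0 ≤ (wordPoly l t w).coeff 0 := by
  induction w with
  | nil => simp [wordPoly]
  | cons c w ih =>
    rw [wordPoly, coeff_add, mul_coeff_zero, coeff_X_pow]
    have h1 : (0 : ℤ) ≤ (if c = t then 1 else 0 : ℤ[X]).coeff 0 := by split_ifs <;> simp
    have h2 : (0 : ℤ) ≤ (if 0 = l c then 1 else 0) := by split_ifs <;> simp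
    exact add_nonneg h1 (mul_nonneg h2 ih)

theorem coeff_zero_wordPoly_cons_self (l : T → ℕ) (t : T) (w : List T) :
    0 < (wordPoly l t (t :: w)).coeff 0 := by
  have := coeff_zero_wordPoly_nonneg l t w
  rw [wordPoly, if_pos rfl, coeff_add, mul_coeff_zero, coeff_X_pow, coeff_one_zero]
  split_ifs <;> omega

/-- Constant terms reveal the first letter: of two distinct letters one has positive weight, and a
word starting with it has constant term 0 at the other. Equal first letters cancel. -/
theorem eq_of_wordPoly_eq {l : T → ℕ} (hl : ∀ s t, l s = 0 → l t = 0 → s = t) :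
    ∀ {u v : List T}, (∀ t, wordPoly l t u = wordPoly l t v) → u = v
  | [], [], _ => rfl
  | [], c :: v, h => by
    have := coeff_zero_wordPoly_cons_self l c v
    rw [← h c, wordPoly, coeff_zero] at this
    exact absurd this (lt_irrefl 0)
  | c :: u, [], h => by
    have := coeff_zero_wordPoly_cons_self l c u
    rw [h c, wordPoly, coeff_zero] at this
    exact absurd this (lt_irrefl 0)
  | c :: u, d :: v, h => by
    obtain rfl | hcd := eq_or_ne c d
    · congr 1
      refine eq_of_wordPoly_eq hl fun t => ?_
      have := h t
      rw [wordPoly, wordPoly] at this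
      exact mul_left_cancel₀ (pow_ne_zero _ X_ne_zero) (add_left_cancel this)
    · exfalso
      by_cases hc : l c = 0
      · have hd : l d ≠ 0 := fun hd => hcd (hl c d hc hd)
        have := coeff_zero_wordPoly_cons_self l c u
        rw [h, coeff_zero_wordPoly_cons hd, if_neg hcd.symm] at this
        exact this.false
      · have := coeff_zero_wordPoly_cons_self l d v
        rw [← h, coeff_zero_wordPoly_cons hc, if_neg hcd] at this
        exact this.false

theorem WordEquation.q_eq {n : ℕ} (E : WordEquation n) (x : Fin n) (L : Fin n → ℕ) :
    E.q x L = wordPoly L x E.lhs.toList - wordPoly L x E.rhs.toList := by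
  rw [WordEquation.q, positionPoly_eq_wordPoly, positionPoly_eq_wordPoly]

theorem WordEquation.sum_q_mul {n : ℕ} (E : WordEquation n)
    (f : FreeMonoid (Fin n) →* FreeMonoid T) (l : T → ℕ)
    (L : Fin n → ℕ) (hL : ∀ x, ((f (FreeMonoid.of x)).toList.map l).sum = L x) (t : T) :
    ∑ x, E.q x L * wordPoly l t (f (FreeMonoid.of x)).toList =
      wordPoly l t (f E.lhs).toList - wordPoly l t (f E.rhs).toList := by
  rw [wordPoly_hom f l L hL t E.lhs, wordPoly_hom f l L hL t E.rhs]
  simp only [E.q_eq, sub_mul, Finset.sum_sub_distrib]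

/-- A morphism of length type `L` solves an equation iff the vectors of position polynomials of
all letters are orthogonal to the vector of the polynomials `q`. -/
theorem WordEquation.isSolution_iff {n : ℕ} (E : WordEquation n)
    (h : FreeMonoid (Fin n) →* FreeMonoid T) :
    E.IsSolution h ↔ ∀ t, ∑ x, E.q x (lengthType h) *
      wordPoly (fun _ => 1) t (h (FreeMonoid.of x)).toList = 0 := by
  have key := E.sum_q_mul h (fun _ => 1) (lengthType h) (fun x => by
    simp [lengthType, FreeMonoid.length])
  refine ⟨fun hs t => by rw [key, show h E.lhs = h E.rhs from hs, sub_self], fun H => ?_⟩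
  exact FreeMonoid.toList.injective
    (eq_of_wordPoly_eq (fun _ _ h1 => absurd h1 one_ne_zero)
      fun t => sub_eq_zero.1 ((key t).symm.trans (H t)))

theorem WordEquation.exists_q_ne_zero {n : ℕ} {E : WordEquation n} {L : Fin n → ℕ}
    (hL : ∀ j k, L j = 0 → L k = 0 → j = k) (hE : ¬ E.IsTrivial) : ∃ x, E.q x L ≠ 0 := by
  by_contra! H
  exact hE (FreeMonoid.toList.injective
    (eq_of_wordPoly_eq hL fun t => sub_eq_zero.1 ((E.q_eq t L).symm.trans (H t))))

end WordPoly

/-! ### Absorbing letters that begin no image -/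

section Regroup

variable {T : Type*} [DecidableEq T]

/-- Write a word uniquely as `b ^ k` followed by blocks `c * b ^ i` with `c ≠ b`, each block
being recorded as `(c, i)`. -/
def splitBlocks (b : T) : List T → ℕ × List (T × ℕ)
  | [] => (0, [])
  | c :: w =>
    if c = b then ((splitBlocks b w).1 + 1, (splitBlocks b w).2)
    else (0, (c, (splitBlocks b w).1) :: (splitBlocks b w).2)

/-- As v does not begin with b, no block straddles the junction. -/
theorem splitBlocks_append (b : T) (u : List T) {v : List T} (hv : (splitBlocks b v).1 = 0) :
    splitBlocks b (u ++ v) =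
      ((splitBlocks b u).1, (splitBlocks b u).2 ++ (splitBlocks b v).2) := by
  induction u with
  | nil => simp [splitBlocks, Prod.ext_iff, hv]
  | cons c u ih =>
    simp only [List.cons_append, splitBlocks, ih]
    split_ifs <;> simp

theorem length_splitBlocks (b : T) (w : List T) :
    (splitBlocks b w).2.length + w.count b = w.length := by
  induction w with
  | nil => simp [splitBlocks]
  | cons c w ih =>
    by_cases h : c = b
    · simp [splitBlocks, h]; omega
    · simp [splitBlocks, h]; omega

theorem splitBlocks_fst_eq_zero {b : T} {w : List T} (h : w.head? ≠ some b) :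
    (splitBlocks b w).1 = 0 := by
  cases w with
  | nil => rfl
  | cons c w => simp_all [splitBlocks]

/-- The morphism expanding a block `(c, i)` to the image of `c * b ^ i`. -/
def expandBlocks {M : Type*} [Monoid M] (b : T) (g : FreeMonoid T →* M) :
    FreeMonoid (T × ℕ) →* M :=
  FreeMonoid.lift fun p => g (FreeMonoid.of p.1) * g (FreeMonoid.of b) ^ p.2

theorem pow_mul_expandBlocks {M : Type*} [Monoid M] (b : T) (g : FreeMonoid T →* M)
    (w : List T) :
    g (FreeMonoid.of b) ^ (splitBlocks b w).1 *
      expandBlocks b g (FreeMonoid.ofList (splitBlocks b w).2) = g (FreeMonoid.ofList w) := by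
  induction w with
  | nil => simp [splitBlocks]
  | cons c w ih =>
    rw [FreeMonoid.ofList_cons, map_mul, ← ih]
    by_cases h : c = b
    · simp [splitBlocks, h, pow_succ', mul_assoc]
    · simp [splitBlocks, h, FreeMonoid.ofList_cons, expandBlocks, mul_assoc]

/-- The morphism obtained from `f` by splitting the images of the generators into blocks. -/
def blockHom {n : ℕ} (b : T) (f : FreeMonoid (Fin n) →* FreeMonoid T) :
    FreeMonoid (Fin n) →* FreeMonoid (T × ℕ) :=
  FreeMonoid.lift fun x => FreeMonoid.ofList (splitBlocks b (f (FreeMonoid.of x)).toList).2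

theorem splitBlocks_hom {n : ℕ} {b : T} {f : FreeMonoid (Fin n) →* FreeMonoid T}
    (hb : ∀ x, (f (FreeMonoid.of x)).toList.head? ≠ some b) (u : FreeMonoid (Fin n)) :
    splitBlocks b (f u).toList = (0, (blockHom b f u).toList) := by
  induction u using FreeMonoid.inductionOn' with
  | one => simp [splitBlocks]
  | of_mul c w ih =>
    rw [map_mul, FreeMonoid.toList_mul, splitBlocks_append _ _ (by rw [ih]), ih,
      splitBlocks_fst_eq_zero (hb c), map_mul, FreeMonoid.toList_mul]
    simp [blockHom]

theorem expandBlocks_blockHom {n : ℕ} {M : Type*} [Monoid M] {b : T}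
    {f : FreeMonoid (Fin n) →* FreeMonoid T}
    (hb : ∀ x, (f (FreeMonoid.of x)).toList.head? ≠ some b) (g : FreeMonoid T →* M)
    (u : FreeMonoid (Fin n)) : expandBlocks b g (blockHom b f u) = g (f u) := by
  have := pow_mul_expandBlocks b g (f u).toList
  simpa [splitBlocks_hom hb u] using this

/-- Every solution `h` of a system factors through a solution `f` such that every letter occurring
in an image of `f` is the first letter of the image of some unknown. -/
theorem exists_factorization_first_letters.{v} {A : Type v} {m n : ℕ} (E : Fin m → WordEquation n)
    (h : FreeMonoid (Fin n) →* FreeMonoid A) (hE : ∀ i, (E i).IsSolution h) :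
    ∃ (T : Type v) (f : FreeMonoid (Fin n) →* FreeMonoid T) (g : FreeMonoid T →* FreeMonoid A),
      (∀ u, g (f u) = h u) ∧ (∀ t, (g (FreeMonoid.of t)).length ≠ 0) ∧
      (∀ i, (E i).IsSolution f) ∧
      ∀ x, ∀ t ∈ (f (FreeMonoid.of x)).toList,
        ∃ y, (f (FreeMonoid.of y)).toList.head? = some t := by
  classical
  suffices H : ∀ (N : ℕ) (T : Type v) (f : FreeMonoid (Fin n) →* FreeMonoid T)
      (g : FreeMonoid T →* FreeMonoid A),
      ∑ x, (f (FreeMonoid.of x)).toList.length = N →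
      (∀ u, g (f u) = h u) → (∀ t, (g (FreeMonoid.of t)).length ≠ 0) →
      (∀ i, (E i).IsSolution f) →
      ∃ (T : Type v) (f : FreeMonoid (Fin n) →* FreeMonoid T)
        (g : FreeMonoid T →* FreeMonoid A),
        (∀ u, g (f u) = h u) ∧ (∀ t, (g (FreeMonoid.of t)).length ≠ 0) ∧
        (∀ i, (E i).IsSolution f) ∧
        ∀ x, ∀ t ∈ (f (FreeMonoid.of x)).toList,
          ∃ y, (f (FreeMonoid.of y)).toList.head? = some t from
    H _ A h (MonoidHom.id _) rfl (fun _ => rfl) (fun t => by simp) hE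
  intro N
  induction N using Nat.strong_induction_on with
  | _ N ih =>
    intro T f g hN hgf hg hf
    by_cases hall : ∀ x, ∀ t ∈ (f (FreeMonoid.of x)).toList,
        ∃ y, (f (FreeMonoid.of y)).toList.head? = some t
    · exact ⟨T, f, g, hgf, hg, hf, hall⟩
    push Not at hall
    obtain ⟨x, b, hbx, hb⟩ := hall
    have hlen : ∀ y, (blockHom b f (FreeMonoid.of y)).toList.length +
        (f (FreeMonoid.of y)).toList.count b = (f (FreeMonoid.of y)).toList.length := fun y => by
      simpa [splitBlocks_hom hb] using length_splitBlocks b (f (FreeMonoid.of y)).toList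
    -- Since b occurs but begins no image, merging each run of b into the letter before it shortens
    -- the total length of the images.
    refine ih _ ?_ (T × ℕ) (blockHom b f) (expandBlocks b g) rfl (fun u => ?_) (fun t => ?_)
      (fun i => ?_)
    · rw [← hN]
      refine Finset.sum_lt_sum (fun y _ => ?_) ⟨x, Finset.mem_univ _, ?_⟩
      · have := hlen y; omega
      · have := hlen x; have := List.count_pos_iff.2 hbx; omega
    · rw [expandBlocks_blockHom hb, hgf]
    · have := hg t.1
      simp only [expandBlocks, FreeMonoid.lift_eval_of, FreeMonoid.length_mul]
      omega
    · have h1 := splitBlocks_hom hb (E i).lhs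
      rw [show f (E i).lhs = f (E i).rhs from hf i, splitBlocks_hom hb] at h1
      exact FreeMonoid.toList.injective (Prod.ext_iff.1 h1).2.symm

end Regroup

/-! ### Linear algebra and the two claims -/

theorem length_hom_eq_sum {T A : Type*} (g : FreeMonoid T →* FreeMonoid A) (w : FreeMonoid T) :
    (w.toList.map fun t => (g (FreeMonoid.of t)).length).sum = (g w).length := by
  induction w using FreeMonoid.inductionOn' with
  | one => simp
  | of_mul c w ih => simp [FreeMonoid.toList_mul, ih]

theorem morphismRank_le_card {n : ℕ} {A T : Type*} {f : FreeMonoid (Fin n) →* FreeMonoid T}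
    {g : FreeMonoid T →* FreeMonoid A} {h : FreeMonoid (Fin n) →* FreeMonoid A}
    (hgf : ∀ u, g (f u) = h u) (B : Set T) [Fintype B]
    (hB : ∀ x, ∀ t ∈ (f (FreeMonoid.of x)).toList, t ∈ B) :
    morphismRank h ≤ Fintype.card B := by
  classical
  let S : Finset (FreeMonoid A) := Finset.univ.image fun b : B => g (FreeMonoid.of b.1)
  refine (Nat.sInf_le ⟨S, rfl, fun x => ?_⟩ : morphismRank h ≤ S.card).trans Finset.card_image_le
  rw [← hgf]
  have key : ∀ w : FreeMonoid T, (∀ t ∈ w.toList, t ∈ B) →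
      g w ∈ Submonoid.closure (S : Set (FreeMonoid A)) := by
    intro w
    induction w using FreeMonoid.inductionOn' with
    | one => intro _; rw [map_one]; exact one_mem _
    | of_mul c w ih =>
      intro hw
      rw [map_mul]
      refine mul_mem (Submonoid.subset_closure ?_) (ih fun t ht => hw t ?_)
      · exact Finset.mem_coe.2 (Finset.mem_image.2
          ⟨⟨c, hw c (by simp [FreeMonoid.toList_mul])⟩, Finset.mem_univ _, rfl⟩)
      · simp [FreeMonoid.toList_mul, ht]
  exact key _ (hB x)

/-- The square submatrix on the rows e b is the identity modulo X, so its determinant is nonzero and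
the columns of V are independent kernel vectors of M. -/
theorem polyRank_add_le_of_orthogonal {m n : ℕ} {B : Type*} [Fintype B] [DecidableEq B]
    (M : Matrix (Fin m) (Fin n) ℤ[X]) (V : Matrix (Fin n) B ℤ[X]) (hMV : M * V = 0)
    (e : B → Fin n) (he : ∀ b c, (V (e b) c).coeff 0 = if b = c then 1 else 0) :
    polyRank M + Fintype.card B ≤ n := by
  set φ := algebraMap ℤ[X] (FractionRing ℤ[X])
  have hdet : (V.submatrix e id).det ≠ 0 := by
    intro h0
    have h1 : (constantCoeff (R := ℤ)).mapMatrix (V.submatrix e id) = 1 := by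
      ext b c
      simpa [Matrix.one_apply] using he b c
    have h2 := RingHom.map_det (constantCoeff (R := ℤ)) (V.submatrix e id)
    rw [h1, h0] at h2
    simp at h2
  have hdet' : ((V.map φ).submatrix e id).det ≠ 0 := by
    rw [show (V.map φ).submatrix e id = φ.mapMatrix (V.submatrix e id) from rfl,
      ← RingHom.map_det]
    exact (map_ne_zero_iff _ (IsFractionRing.injective _ _)).2 hdet
  have hli : Function.Injective (V.map φ).mulVecLin := by
    rw [← LinearMap.ker_eq_bot, LinearMap.ker_eq_bot']
    intro v hv
    refine Matrix.eq_zero_of_mulVec_eq_zero hdet' ?_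
    ext b
    exact congrFun hv (e b)
  have hle : LinearMap.range (V.map φ).mulVecLin ≤ LinearMap.ker (M.map φ).mulVecLin := by
    rintro _ ⟨v, rfl⟩
    rw [LinearMap.mem_ker, Matrix.mulVecLin_apply, Matrix.mulVecLin_apply, Matrix.mulVec_mulVec,
      ← Matrix.map_mul, hMV]
    simp
  have h1 := Submodule.finrank_mono hle
  rw [LinearMap.finrank_range_of_inj hli, Module.finrank_fintype_fun_eq_card] at h1
  have h2 := LinearMap.finrank_range_add_finrank_ker (M.map φ).mulVecLin
  rw [Module.finrank_fintype_fun_eq_card, Fintype.card_fin] at h2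
  change Module.finrank _ (LinearMap.range (M.map φ).mulVecLin) + _ ≤ n
  omega

theorem polyRank_add_morphismRank_le {A : Type*} {m n : ℕ} (E : Fin m → WordEquation n)
    (h : FreeMonoid (Fin n) →* FreeMonoid A) (hE : ∀ i, (E i).IsSolution h) :
    polyRank (qMatrix E (lengthType h)) + morphismRank h ≤ n := by
  classical
  obtain ⟨T, f, g, hgf, hg, hf, hfirst⟩ := exists_factorization_first_letters E h hE
  let B : Set T := {t | ∃ y, (f (FreeMonoid.of y)).toList.head? = some t}
  choose e he using fun b : B => b.2
  have heinj : Function.Injective e := fun b c hbc => by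
    have := he b
    rw [hbc, he c] at this
    exact Subtype.ext (Option.some_injective _ this).symm
  let _ : Fintype B := Fintype.ofInjective e heinj
  -- With these weights f(x) has total weight |h(x)|, as L requires.
  let l : T → ℕ := fun t => (g (FreeMonoid.of t)).length
  let V : Matrix (Fin n) B ℤ[X] :=
    Matrix.of fun x b => wordPoly l b.1 (f (FreeMonoid.of x)).toList
  have hMV : qMatrix E (lengthType h) * V = 0 := by
    ext1 i b
    have := (E i).sum_q_mul f l (lengthType h)
      (fun x => by rw [length_hom_eq_sum, hgf]; rfl) b.1
    rw [show f (E i).lhs = f (E i).rhs from hf i, sub_self] at this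
    simpa [Matrix.mul_apply, qMatrix, V] using this
  have h1 := polyRank_add_le_of_orthogonal _ V hMV e fun b c => by
    obtain ⟨w, hw⟩ := List.head?_eq_some_iff.1 (he b)
    simp only [V, Matrix.of_apply]
    rw [hw, coeff_zero_wordPoly_cons (l := l) (hg _)]
    simp [Subtype.ext_iff]
  have h2 := morphismRank_le_card hgf B hfirst
  omega

/-- The row space is a line spanned by the nonzero row i, so row i' is a multiple of it over the
fraction field. -/
theorem mul_row_of_polyRank_eq_one {m n : ℕ} {M : Matrix (Fin m) (Fin n) ℤ[X]}
    (hM : polyRank M = 1) {i : Fin m} (hi : ∃ x, M i x ≠ 0) (i' : Fin m) {p : Fin n → ℤ[X]}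
    (hp : ∑ x, M i x * p x = 0) : ∑ x, M i' x * p x = 0 := by
  set φ := algebraMap ℤ[X] (FractionRing ℤ[X])
  have hφ : Function.Injective φ := IsFractionRing.injective _ _
  have h1 : Module.finrank (FractionRing ℤ[X])
      (Submodule.span (FractionRing ℤ[X]) (Set.range (M.map φ).row)) = 1 := by
    rw [← Matrix.rank_eq_finrank_span_row]; exact hM
  have mem : ∀ k, (M.map φ).row k ∈
      Submodule.span (FractionRing ℤ[X]) (Set.range (M.map φ).row) :=
    fun k => Submodule.subset_span ⟨k, rfl⟩
  obtain ⟨x, hx⟩ := hi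
  have hne : (⟨_, mem i⟩ :
      Submodule.span (FractionRing ℤ[X]) (Set.range (M.map φ).row)) ≠ 0 := by
    intro h0
    exact hx (hφ ((congrFun (Subtype.ext_iff.1 h0) x).trans (map_zero φ).symm))
  obtain ⟨c, hc⟩ := (finrank_eq_one_iff_of_nonzero' _ hne).1 h1 ⟨_, mem i'⟩
  have hrow : ∀ y, c * φ (M i y) = φ (M i' y) := fun y => congrFun (Subtype.ext_iff.1 hc) y
  refine hφ ?_
  have := congrArg (fun z => c * φ z) hp
  simpa [Finset.mul_sum, ← mul_assoc, hrow] using this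

theorem mainTheorem5 {A : Type*} {m n : ℕ} (E : Fin m → WordEquation n) (L : Fin n → ℕ) :
    (∀ (h : FreeMonoid (Fin n) →* FreeMonoid A) (r : ℕ),
      (∀ i, (E i).IsSolution h) → lengthType h = L → morphismRank h = r →
        (polyRank (qMatrix E L) : ℤ) ≤ (n : ℤ) - (r : ℤ)) ∧
    (polyRank (qMatrix E L) = 1 →
      (∀ j k, L j = 0 → L k = 0 → j = k) →
      (∀ i, ¬ (E i).IsTrivial) →
        ∀ (i i' : Fin m) (h : FreeMonoid (Fin n) →* FreeMonoid A), lengthType h = L →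
          ((E i).IsSolution h ↔ (E i').IsSolution h)) := by
  classical
  refine ⟨?_, fun hrank hL hE => ?_⟩
  · rintro h r hE rfl rfl
    have := polyRank_add_morphismRank_le E h hE
    omega
  · have key : ∀ (i i' : Fin m) (h : FreeMonoid (Fin n) →* FreeMonoid A), lengthType h = L →
        (E i).IsSolution h → (E i').IsSolution h := by
      rintro i i' h rfl hs
      rw [WordEquation.isSolution_iff] at hs ⊢
      exact fun t => mul_row_of_polyRank_eq_one hrank
        (i := i) (WordEquation.exists_q_ne_zero hL (hE i)) i' (hs t)
    exact fun i i' h hh => ⟨key i i' h hh, key i' i h hh⟩
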